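/- Let $n\ge 2$ with $n\equiv 1$ or $9 \pmod{12}$, and let $\mathcal{B}$ be a Steiner triple system on $\{1,\dots,n\}$, i.e. a collection of three-element subsets (blocks) such that every pair of distinct points is contained in exactly one block. Let $$P_{\mathcal{B}}(x)=\sum_{\{a,b,c\}\in\mathcal{B}}x_ax_bx_c,\qquad P_n(x)=\frac{\sqrt{n(n+1)}}{6}\sum_{j=2}^{n}\frac{1}{\sqrt{j(j+1)}}\sum_{i=1}^{j-1}\left(x_j^3-3x_jx_i^2\right)$$ be, respectively, the cubic polynomial of $\mathcal{B}$ and the simplicial polynomial on Euclidean $\mathbb{R}^n$. Then: (1) $P_{\mathcal{B}}$ is not conformally linearly equivalent to $P_n$: there is no $g=rA$ with $0\ne r\in\mathbb{R}$ and $A\in O(n)$ such that $P_{\mathcal{B}}(g^{-1}x)=P_n(x)$ for all $x\in\mathbb{R}^n$; (2) $P_{\mathcal{B}}$ is not conformally associative: for $P=P_{\mathcal{B}}$, the tensor $$A_{ijkl}+\tfrac{1}{n-2}\left(\delta_{ki}R_{jl}-\delta_{kj}R_{il}-\delta_{li}R_{jk}+\delta_{lj}R_{ik}\right)-\tfrac{S}{(n-1)(n-2)}\left(\delta_{ki}\delta_{jl}-\delta_{kj}\delta_{il}\right)$$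 is not identically zero, where $P_{ijk}=\partial_i\partial_j\partial_kP$, $A_{ijkl}=\sum_p\left(P_{lip}P_{jkp}-P_{ljp}P_{ikp}\right)$, $R_{ij}=\sum_pA_{pijp}$ and $S=\sum_pR_{pp}$. -/

import Mathlib

open MvPolynomial

noncomputable section

/-- A Steiner triple system on the point set `Fin n`: a collection of three-element blocks such
that every pair of distinct points lies in exactly one block. -/
structure IsSteinerTripleSystem {n : ℕ} (B : Finset (Finset (Fin n))) : Prop where
  card_block : ∀ b ∈ B, b.card = 3
  existsUnique_block : ∀ i j : Fin n, i ≠ j → ∃! b, b ∈ B ∧ i ∈ b ∧ j ∈ b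

/-- The cubic polynomial `P_B = ∑_{abc ∈ B} x_a x_b x_c` on `ℝⁿ`. -/
def steinerCubic {n : ℕ} (B : Finset (Finset (Fin n))) : MvPolynomial (Fin n) ℝ :=
  ∑ b ∈ B, ∏ a ∈ b, X a

/-- The simplicial polynomial
`P_n = (√(n(n+1)) / 6) ∑_{j=2}^n (1 / √(j(j+1))) ∑_{i=1}^{j-1} (x_j³ - 3 x_j x_i²)` on `ℝⁿ`.
The coordinate `x_j` (`1 ≤ j ≤ n`) is `X ⟨j - 1, _⟩`, so that `j : Fin n` below stands for the index
`j + 1`; the first summand (`j = 0`) has an empty inner sum. -/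
def simplicialPoly (n : ℕ) : MvPolynomial (Fin n) ℝ :=
  C (√((n : ℝ) * ((n : ℝ) + 1)) / 6) *
    ∑ j : Fin n, C (1 / √(((j : ℕ) + 1 : ℝ) * ((j : ℕ) + 2 : ℝ))) *
      ∑ i ∈ Finset.Iio j, (X j ^ 3 - 3 * X j * X i ^ 2)

/-- The group `CO(n)` of conformal linear transformations of Euclidean `ℝⁿ`: the invertible
matrices of the form `r A` with `r` a nonzero real number and `A` an orthogonal matrix. -/
def conformalLinearGroup (n : ℕ) : Subgroup (GL (Fin n) ℝ) where
  carrier := {g | ∃ r : ℝ, r ≠ 0 ∧ ∃ A ∈ Matrix.orthogonalGroup (Fin n) ℝ,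
    (g : Matrix (Fin n) (Fin n) ℝ) = r • A}
  one_mem' := ⟨1, one_ne_zero, 1, one_mem _, by simp⟩
  mul_mem' := by
    rintro g h ⟨r, hr, A, hA, hg⟩ ⟨s, hs, B, hB, hh⟩
    refine ⟨r * s, mul_ne_zero hr hs, A * B, mul_mem hA hB, ?_⟩
    rw [Units.val_mul, hg, hh, Matrix.smul_mul, Matrix.mul_smul, smul_smul]
  inv_mem' := by
    rintro g ⟨r, hr, A, hA, hg⟩
    refine ⟨r⁻¹, inv_ne_zero hr, star A, Unitary.star_mem hA, ?_⟩
    refine Units.inv_eq_of_mul_eq_one_right ?_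
    rw [hg, Matrix.smul_mul, Matrix.mul_smul, smul_smul, mul_inv_cancel₀ hr, one_smul]
    exact (Matrix.mem_orthogonalGroup_iff _ _).1 hA

/-- The left action of `GL(n, ℝ)` on polynomials, `(g · P)(x) = P(g⁻¹ x)`. -/
def glAct {n : ℕ} (g : GL (Fin n) ℝ) (P : MvPolynomial (Fin n) ℝ) : MvPolynomial (Fin n) ℝ :=
  aeval (fun i => ∑ j, C ((g⁻¹ : GL (Fin n) ℝ).val i j) * X j) P

/-- As a function on `ℝⁿ`, `g · P` is `x ↦ P(g⁻¹ x)`. -/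
theorem eval_glAct {n : ℕ} (g : GL (Fin n) ℝ) (P : MvPolynomial (Fin n) ℝ) (x : Fin n → ℝ) :
    eval x (glAct g P) = eval (((g⁻¹ : GL (Fin n) ℝ).val).mulVec x) P := by
  unfold glAct
  induction P using MvPolynomial.induction_on with
  | C a => simp
  | add p q hp hq => simp only [map_add, hp, hq]
  | mul_X p i hp =>
    rw [map_mul, map_mul, map_mul, hp, aeval_X, eval_X]
    simp [Matrix.mulVec, dotProduct]

/-- Conformal linear equivalence: `P` and `Q` lie on the same orbit of `CO(n)`. -/
def ConformallyEquivalent {n : ℕ} (P Q : MvPolynomial (Fin n) ℝ) : Prop :=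
  ∃ g ∈ conformalLinearGroup n, glAct g P = Q

/-- The components `F_{ijk}` of the third derivative of `F` in the standard orthonormal
coordinates. -/
def thirdDeriv {n : ℕ} (F : MvPolynomial (Fin n) ℝ) (i j k : Fin n) : MvPolynomial (Fin n) ℝ :=
  pderiv i (pderiv j (pderiv k F))

/-- The components `h_{ij}` of the Euclidean metric. -/
def euclideanMetric {n : ℕ} (i j : Fin n) : MvPolynomial (Fin n) ℝ := if i = j then 1 else 0

/-- The nonassociativity tensor
`𝒜(F)_{ijkl} = 2 F_{l[i}^p F_{j]kp} = ∑ₚ (F_{lip} F_{jkp} - F_{ljp} F_{ikp})`. -/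
def nonassociativity {n : ℕ} (F : MvPolynomial (Fin n) ℝ) (i j k l : Fin n) :
    MvPolynomial (Fin n) ℝ :=
  ∑ p, (thirdDeriv F l i p * thirdDeriv F j k p - thirdDeriv F l j p * thirdDeriv F i k p)

/-- The Ricci-type trace `ρ_{ij} = 𝒜(F)_{pij}^p`. -/
def nonassociativityRicci {n : ℕ} (F : MvPolynomial (Fin n) ℝ) (i j : Fin n) :
    MvPolynomial (Fin n) ℝ :=
  ∑ p, nonassociativity F p i j p

/-- The scalar trace `σ = ρ_p^p`. -/
def nonassociativityScalar {n : ℕ} (F : MvPolynomial (Fin n) ℝ) : MvPolynomial (Fin n) ℝ :=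
  ∑ p, nonassociativityRicci F p p

/-- The conformal nonassociativity tensor (meaningful for `n ≥ 3`)
`𝒜(F)_{ijkl} + (2/(n-2)) (h_{k[i} ρ_{j]l} - h_{l[i} ρ_{j]k}) - (2/((n-1)(n-2))) σ h_{k[i} h_{j]l}`,
where `2 T_{[ij]} = T_{ij} - T_{ji}`. -/
def conformalNonassociativity {n : ℕ} (F : MvPolynomial (Fin n) ℝ) (i j k l : Fin n) :
    MvPolynomial (Fin n) ℝ :=
  nonassociativity F i j k l
    + C (1 / ((n : ℝ) - 2)) *
      ((euclideanMetric k i * nonassociativityRicci F j l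
          - euclideanMetric k j * nonassociativityRicci F i l)
        - (euclideanMetric l i * nonassociativityRicci F j k
          - euclideanMetric l j * nonassociativityRicci F i k))
    - C (1 / (((n : ℝ) - 1) * ((n : ℝ) - 2))) * nonassociativityScalar F *
      (euclideanMetric k i * euclideanMetric j l - euclideanMetric k j * euclideanMetric i l)

/-- `P` is conformally associative if its conformal nonassociativity tensor vanishes. -/
def ConformallyAssociative {n : ℕ} (P : MvPolynomial (Fin n) ℝ) : Prop :=
  ∀ i j k l : Fin n, conformalNonassociativity P i j k l = 0

end

/-! Both parts derive `n % 4 = 3` from a structure on the blocks, whereas the hypothesis gives `n %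
4 = 1`. Write `t i j` for the third point of the block through `i` and `j`.

Inequivalence rests on a conformal invariant: vectors `v` for which the quadratic part of `P(x+v) -
P(x-v)` is a multiple of the squared norm plus a multiple of the square of a linear form. The
simplicial polynomial has two independent ones. For a Steiner cubic, such a vector is zero or, after
scaling, a ±1 labelling of the points with product 1 on every block. A nonconstant labelling would
have a geometric hyperplane as its `+1` set, forcing `n % 4 = 3`
(`IsThirdPoint.eq_one_of_mul_eq_one`). Hence all such vectors are constant, so any two are
dependent.

Conformal associativity makes intersecting blocks generate Fano planes. A fixed block then yields a
Klein four-group acting freely on the other points, so `4 ∣ n - 3`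
(`IsThirdPoint.mod_four_of_fano`). -/

theorem Finset.even_card_of_involution {α : Type*} [DecidableEq α] (s : Finset α) (f : α → α)
    (hmem : ∀ x ∈ s, f x ∈ s) (hne : ∀ x ∈ s, f x ≠ x) (hinv : ∀ x ∈ s, f (f x) = x) :
    Even s.card := by
  have h : ∑ _x ∈ s, (1 : ZMod 2) = 0 :=
    Finset.sum_involution (fun x _ => f x) (fun _ _ => by decide) (fun x hx _ => hne x hx)
      hmem hinv
  rw [Finset.sum_const, nsmul_one] at h
  exact (ZMod.natCast_eq_zero_iff_even).1 h

/-! ### Combinatorics of Steiner triple systems -/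

/-- The third point of the block through two distinct points of a Steiner triple system. -/
structure IsThirdPoint {n : ℕ} (B : Finset (Finset (Fin n))) (t : Fin n → Fin n → Fin n) :
    Prop where
  mem : ∀ i j, i ≠ j → {i, j, t i j} ∈ B
  ne_left : ∀ i j, i ≠ j → t i j ≠ i
  ne_right : ∀ i j, i ≠ j → t i j ≠ j
  block_eq : ∀ i j, i ≠ j → ∀ b ∈ B, i ∈ b → j ∈ b → b = {i, j, t i j}

theorem IsSteinerTripleSystem.exists_isThirdPoint {n : ℕ} {B : Finset (Finset (Fin n))}
    (hB : IsSteinerTripleSystem B) : ∃ t, IsThirdPoint B t := by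
  have key : ∀ i j : Fin n, ∃ k, i ≠ j → ({i, j, k} ∈ B ∧ k ≠ i ∧ k ≠ j ∧
      ∀ b ∈ B, i ∈ b → j ∈ b → b = {i, j, k}) := by
    intro i j
    by_cases hij : i = j
    · exact ⟨i, fun h => absurd hij h⟩
    obtain ⟨b, ⟨hb, hi, hj⟩, huniq⟩ := hB.existsUnique_block i j hij
    have hsub : {i, j} ⊆ b := by simp [Finset.insert_subset_iff, hi, hj]
    have hcard : (b \ {i, j}).card = 1 := by
      rw [Finset.card_sdiff_of_subset hsub, hB.card_block b hb, Finset.card_pair hij]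
    obtain ⟨k, hk⟩ := Finset.card_eq_one.1 hcard
    have hkb : k ∈ b \ {i, j} := by simp [hk]
    have hbe : b = {i, j, k} := by
      ext x
      have : x ∈ b \ {i, j} ↔ x = k := by simp [hk]
      simp only [Finset.mem_sdiff, Finset.mem_insert, Finset.mem_singleton] at this hkb ⊢
      constructor
      · intro hx; tauto
      · rintro (rfl | rfl | rfl) <;> tauto
    simp only [Finset.mem_sdiff, Finset.mem_insert, Finset.mem_singleton, not_or] at hkb
    refine ⟨k, fun _ => ⟨hbe ▸ hb, hkb.2.1, hkb.2.2, fun b' h1 h2 h3 => ?_⟩⟩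
    rw [huniq b' ⟨h1, h2, h3⟩, hbe]
  choose t ht using key
  exact ⟨t, fun i j h => (ht i j h).1, fun i j h => (ht i j h).2.1,
    fun i j h => (ht i j h).2.2.1, fun i j h => (ht i j h).2.2.2⟩

namespace IsThirdPoint

variable {n : ℕ} {B : Finset (Finset (Fin n))} {t : Fin n → Fin n → Fin n}

theorem eq_of_mem (ht : IsThirdPoint B t) {i j k : Fin n} (hij : i ≠ j) (hki : k ≠ i)
    (hkj : k ≠ j) (h : {i, j, k} ∈ B) : t i j = k := by
  have h1 := ht.block_eq i j hij _ h (by simp) (by simp)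
  have : k ∈ ({i, j, t i j} : Finset (Fin n)) := h1 ▸ (by simp)
  simp only [Finset.mem_insert, Finset.mem_singleton] at this
  tauto

theorem comm (ht : IsThirdPoint B t) {i j : Fin n} (hij : i ≠ j) : t i j = t j i := by
  refine ht.eq_of_mem hij (ht.ne_right j i hij.symm) (ht.ne_left j i hij.symm) ?_
  rw [Finset.insert_comm]
  exact ht.mem j i hij.symm

theorem left_inv (ht : IsThirdPoint B t) {i j : Fin n} (hij : i ≠ j) : t i (t i j) = j := by
  refine ht.eq_of_mem (ht.ne_left i j hij).symm hij.symm (ht.ne_right i j hij).symm ?_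
  rw [Finset.pair_comm]
  exact ht.mem i j hij

/-- A Steiner triple system whose order is `1` modulo `4` has no geometric hyperplane. -/
theorem eq_one_of_mul_eq_one (ht : IsThirdPoint B t) (hmod : n % 4 = 1) (hn : 1 < n)
    (δ : Fin n → ℝ) (hδ : ∀ i, δ i = 1 ∨ δ i = -1)
    (hmul : ∀ i j, i ≠ j → δ i * δ j * δ (t i j) = 1) (i : Fin n) : δ i = 1 := by
  classical
  by_contra hi
  have hi' : δ i = -1 := (hδ i).resolve_left hi
  set Z := Finset.univ.filter fun x => δ x = 1 with hZ
  set N := Finset.univ.filter fun x => ¬ δ x = 1 with hN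
  have hsum : Z.card + N.card = n := by
    rw [hZ, hN, Finset.card_filter_add_card_filter_not]; simp
  have hiN : i ∈ N := by simp [hN, hi]
  -- On a block through `i` the product is 1 and `δ i = -1`, so the other two signs differ: `t i`
  -- exchanges `Z` and `N \ {i}`.
  have hZN : Z.card = (N.erase i).card := by
    refine Finset.card_nbij' (t i) (t i) ?_ ?_ ?_ ?_
    · intro x hx
      have hx1 : δ x = 1 := by simpa [hZ] using hx
      have hne : i ≠ x := by rintro rfl; exact hi hx1
      have h := hmul i x hne
      simp only [Finset.coe_erase, Set.mem_sdiff, Finset.mem_coe, Set.mem_singleton_iff]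
      refine ⟨?_, ht.ne_left i x hne⟩
      simp only [hN, Finset.mem_filter, Finset.mem_univ, true_and]
      rw [hi', hx1] at h
      intro h'; rw [h'] at h; norm_num at h
    · intro x hx
      have hx' : ¬ δ x = 1 ∧ x ≠ i := by simpa [hN] using hx
      have hx1 := (hδ x).resolve_left hx'.1
      have h := hmul i x hx'.2.symm
      simp only [hZ, Finset.coe_filter, Finset.mem_univ, true_and, Set.mem_ofPred_eq]
      rw [hi', hx1] at h
      linarith
    · intro x hx
      have hx1 : δ x = 1 := by simpa [hZ] using hx
      exact ht.left_inv (by rintro rfl; exact hi hx1)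
    · intro x hx
      have hx' : ¬ δ x = 1 ∧ x ≠ i := by simpa [hN] using hx
      exact ht.left_inv hx'.2.symm
  rw [Finset.card_erase_of_mem hiN] at hZN
  have hNpos : 0 < N.card := Finset.card_pos.2 ⟨i, hiN⟩
  obtain ⟨z, hz⟩ : Z.Nonempty := Finset.card_pos.1 (by omega)
  have hz1 : δ z = 1 := by simpa [hZ] using hz
  -- Two points of `Z` have their third point in `Z`, so `t z` pairs off `Z \ {z}`. Thus `Z.card` is
  -- odd and `n = 2 * Z.card + 1` is 3 modulo 4.
  have heven : Even (Z.erase z).card := by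
    refine Finset.even_card_of_involution _ (t z) ?_ ?_ ?_
    · intro x hx
      have hx' : x ≠ z ∧ δ x = 1 := by simpa [hZ] using hx
      have h := hmul z x hx'.1.symm
      rw [hz1, hx'.2] at h
      simp only [hZ, Finset.mem_erase, Finset.mem_filter, Finset.mem_univ, true_and]
      exact ⟨ht.ne_left z x hx'.1.symm, by linarith⟩
    · intro x hx
      exact ht.ne_right z x (Finset.ne_of_mem_erase hx).symm
    · intro x hx
      exact ht.left_inv (Finset.ne_of_mem_erase hx).symm
  rw [Finset.card_erase_of_mem hz] at heven
  have hZpos : 0 < Z.card := Finset.card_pos.2 ⟨z, hz⟩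
  rw [Nat.even_iff] at heven
  omega

/-- If any two intersecting blocks generate a Fano plane, the order is `3` modulo `4`. -/
theorem mod_four_of_fano (ht : IsThirdPoint B t) (hn : 1 < n)
    (hfano : ∀ a b c d, a ≠ b → a ≠ c → b ≠ d → c ≠ d → t a b = t c d → t a c = t b d) : n % 4 = 3 := by
  classical
  obtain ⟨p, i, hpi⟩ : ∃ p i : Fin n, p ≠ i :=
    ⟨⟨0, by omega⟩, ⟨1, hn⟩, by simp⟩
  -- Both `t u (t u v)` and `t (t v x) x` equal `v`; the Fano condition for these two pairs is the
  -- claim.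
  have comp : ∀ u v x, u ≠ v → x ≠ u → x ≠ v → x ≠ t u v →
      t u (t v x) = t (t u v) x := by
    intro u v x huv hxu hxv hxw
    have e0 : t v x ≠ x := ht.ne_right v x hxv.symm
    have e1 : t v x ≠ v := ht.ne_left v x hxv.symm
    have e2 : t v x ≠ u := by
      intro h
      apply hxw
      rw [ht.comm huv, ← h, ht.left_inv hxv.symm]
    have e4 : t u v ≠ u := ht.ne_left u v huv
    have h1 : t (t v x) x = v := by
      rw [ht.comm e0, ht.comm hxv.symm, ht.left_inv hxv]
    have h2 : t u (t u v) = v := ht.left_inv huv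
    exact hfano u (t u v) (t v x) x e4.symm e2.symm hxw.symm e0 (by rw [h1, h2])
  set q := t p i with hq
  have hqp : q ≠ p := ht.ne_left p i hpi
  have hqi : q ≠ i := ht.ne_right p i hpi
  have hip : t i p = q := (ht.comm hpi).symm
  have hpq : t p q = i := ht.left_inv hpi
  have hqp' : t q p = i := by rw [ht.comm hqp, hpq]
  have hiq : t i q = p := by rw [← hip, ht.left_inv hpi.symm]
  have hqi' : t q i = p := by rw [ht.comm hqi, hiq]
  set S : Finset (Fin n) := Finset.univ \ {p, i, q} with hS
  have memS : ∀ x, x ∈ S ↔ x ≠ p ∧ x ≠ i ∧ x ≠ q := by intro x; simp [hS]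
  have hScard : S.card + 3 = n := by
    have h3 : ({p, i, q} : Finset (Fin n)).card = 3 := by
      rw [Finset.card_eq_three]
      exact ⟨p, i, q, hpi, hqp.symm, hqi.symm, rfl⟩
    have := Finset.card_sdiff_add_card_eq_card (Finset.subset_univ ({p, i, q} : Finset (Fin n)))
    rw [h3] at this
    simpa using this
  -- By `comp`, the identity and `t p`, `t i`, `t q` form a Klein four-group on `S`, and `F x` is
  -- the orbit of `x`.
  let F : Fin n → Finset (Fin n) := fun x => {x, t p x, t i x, t q x}
  have stay : ∀ u v w x, u ≠ v → u ≠ w → t u v = w → t u w = v →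
      x ≠ u → x ≠ v → x ≠ w → t u x ≠ u ∧ t u x ≠ v ∧ t u x ≠ w := by
    intro u v w x huv huw h1 h2 hxu hxv hxw
    refine ⟨ht.ne_left u x hxu.symm, fun h => hxw ?_, fun h => hxv ?_⟩
    · rw [← h1, ← h, ht.left_inv hxu.symm]
    · rw [← h2, ← h, ht.left_inv hxu.symm]
  have hFS : ∀ x ∈ S, F x ⊆ S := by
    intro x hx y hy
    obtain ⟨h1, h2, h3⟩ := (memS x).1 hx
    simp only [F, Finset.mem_insert, Finset.mem_singleton] at hy
    rw [memS]
    rcases hy with rfl | rfl | rfl | rfl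
    · exact ⟨h1, h2, h3⟩
    · exact stay p i q x hpi hqp.symm hq.symm hpq h1 h2 h3
    · have := stay i p q x hpi.symm hqi.symm hip hiq h2 h1 h3
      exact ⟨this.2.1, this.1, this.2.2⟩
    · have := stay q p i x hqp hqi hqp' hqi' h3 h1 h2
      exact ⟨this.2.1, this.2.2, this.1⟩
  have hFcard : ∀ x ∈ S, (F x).card = 4 := by
    intro x hx
    obtain ⟨h1, h2, h3⟩ := (memS x).1 hx
    have inj : ∀ u v, u ≠ v → x ≠ u → x ≠ v → t u x ≠ t v x := by
      intro u v huv hu hv h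
      apply huv
      have e1 : t x (t u x) = u := by rw [ht.comm hu.symm, ht.left_inv hu]
      have e2 : t x (t v x) = v := by rw [ht.comm hv.symm, ht.left_inv hv]
      rw [← e1, h, e2]
    have d1 := ht.ne_right p x h1.symm
    have d2 := ht.ne_right i x h2.symm
    have d3 := ht.ne_right q x h3.symm
    have d4 := inj p i hpi h1 h2
    have d5 := inj p q hqp.symm h1 h3
    have d6 := inj i q hqi.symm h2 h3
    simp only [F]
    rw [Finset.card_insert_of_notMem, Finset.card_insert_of_notMem,
      Finset.card_insert_of_notMem, Finset.card_singleton] <;>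
      simp [d1.symm, d2.symm, d3.symm, d4, d5, d6]
  have hFeq : ∀ x ∈ S, ∀ y ∈ F x, F y = F x := by
    intro x hx y hy
    obtain ⟨h1, h2, h3⟩ := (memS x).1 hx
    have cpi : t p (t i x) = t q x := comp p i x hpi h1 h2 h3
    have cip : t i (t p x) = t q x := by
      have := comp i p x hpi.symm h2 h1 (by rwa [hip]); rwa [hip] at this
    have cpq : t p (t q x) = t i x := by
      have := comp p q x hqp.symm h1 h3 (by rwa [hpq]); rwa [hpq] at this
    have cqp : t q (t p x) = t i x := by
      have := comp q p x hqp h3 h1 (by rwa [hqp']); rwa [hqp'] at this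
    have ciq : t i (t q x) = t p x := by
      have := comp i q x hqi.symm h2 h3 (by rwa [hiq]); rwa [hiq] at this
    have cqi : t q (t i x) = t p x := by
      have := comp q i x hqi h3 h2 (by rwa [hqi']); rwa [hqi'] at this
    have lp := ht.left_inv h1.symm
    have li := ht.left_inv h2.symm
    have lq := ht.left_inv h3.symm
    simp only [F, Finset.mem_insert, Finset.mem_singleton] at hy
    rcases hy with rfl | rfl | rfl | rfl
    · rfl
    · ext z
      simp only [F, lp, cip, cqp, Finset.mem_insert, Finset.mem_singleton]; tauto
    · ext z
      simp only [F, li, cpi, cqi, Finset.mem_insert, Finset.mem_singleton]; tauto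
    · ext z
      simp only [F, lq, cpq, ciq, Finset.mem_insert, Finset.mem_singleton]; tauto
  -- The fibres of `F` on `S` are the orbits themselves, each of size 4.
  have hdvd : 4 ∣ S.card := by
    rw [Finset.card_eq_sum_card_image F S]
    refine Finset.dvd_sum fun b hb => ?_
    obtain ⟨x, hx, rfl⟩ := Finset.mem_image.1 hb
    have : S.filter (fun y => F y = F x) = F x := by
      ext y
      rw [Finset.mem_filter]
      constructor
      · rintro ⟨-, hy⟩
        rw [← hy]; simp [F]
      · exact fun hy => ⟨hFS x hx hy, hFeq x hx y hy⟩
    rw [this, hFcard x hx]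
  omega

end IsThirdPoint

/-! ### Third derivatives and conformal associativity -/

theorem pderiv_prod_X {σ : Type*} [DecidableEq σ] (b : Finset σ) (k : σ) :
    pderiv k (∏ a ∈ b, (X a : MvPolynomial σ ℝ)) =
      if k ∈ b then ∏ a ∈ b.erase k, X a else 0 := by
  induction b using Finset.induction_on with
  | empty => simp
  | insert x s hx ih =>
    rw [Finset.prod_insert hx, Derivation.leibniz, ih]
    by_cases hk : k = x
    · subst hk
      simp [hx]
    · have hxk : x ≠ k := fun h => hk h.symm
      rw [pderiv_X_of_ne hxk]
      by_cases hks : k ∈ s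
      · rw [Finset.erase_insert_of_ne hxk, Finset.prod_insert (by simp [hx])]
        simp [hks]
      · simp [hks, hk]

theorem thirdDeriv_prod_X {n : ℕ} (b : Finset (Fin n)) (hb : b.card = 3) (i j k : Fin n) :
    thirdDeriv (∏ a ∈ b, X a) i j k =
      if k ∈ b ∧ j ∈ b ∧ j ≠ k ∧ i ∈ b ∧ i ≠ j ∧ i ≠ k then 1 else 0 := by
  unfold thirdDeriv
  rw [pderiv_prod_X]
  by_cases hk : k ∈ b
  swap
  · simp [hk]
  rw [if_pos hk, pderiv_prod_X]
  by_cases hj : j ∈ b.erase k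
  swap
  · rw [if_neg hj, map_zero, if_neg]
    simp only [Finset.mem_erase] at hj
    tauto
  rw [if_pos hj, pderiv_prod_X]
  by_cases hi : i ∈ (b.erase k).erase j
  · have hempty : ((b.erase k).erase j).erase i = ∅ := by
      rw [← Finset.card_eq_zero, Finset.card_erase_of_mem hi, Finset.card_erase_of_mem hj,
        Finset.card_erase_of_mem hk, hb]
    rw [if_pos hi, hempty, Finset.prod_empty, if_pos]
    simp only [Finset.mem_erase] at hi hj
    tauto
  · rw [if_neg hi, if_neg]
    simp only [Finset.mem_erase] at hi hj
    tauto

namespace IsThirdPoint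

variable {n : ℕ} {B : Finset (Finset (Fin n))} {t : Fin n → Fin n → Fin n}

theorem thirdDeriv_steinerCubic (hB : IsSteinerTripleSystem B) (ht : IsThirdPoint B t)
    {i j : Fin n} (hij : i ≠ j) (k : Fin n) :
    thirdDeriv (steinerCubic B) i j k = if k = t i j then 1 else 0 := by
  have hsum : thirdDeriv (steinerCubic B) i j k
      = ∑ b ∈ B, thirdDeriv (∏ a ∈ b, X a) i j k := by
    simp [thirdDeriv, steinerCubic, map_sum]
  rw [hsum, Finset.sum_eq_single {i, j, t i j}]
  · rw [thirdDeriv_prod_X _ (hB.card_block _ (ht.mem i j hij))]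
    have h1 := ht.ne_left i j hij
    have h2 := ht.ne_right i j hij
    refine if_congr ?_ rfl rfl
    simp only [Finset.mem_insert, Finset.mem_singleton]
    constructor
    · rintro ⟨h, -, h3, -, -, h4⟩
      rcases h with h | h | h
      · exact absurd h.symm h4
      · exact absurd h.symm h3
      · exact h
    · rintro rfl
      exact ⟨by simp, by simp, h2.symm, by simp, hij, h1.symm⟩
  · intro b hb hne
    rw [thirdDeriv_prod_X _ (hB.card_block _ hb), if_neg]
    rintro ⟨-, hj, -, hi, -, -⟩
    exact hne (ht.block_eq i j hij b hb hi hj)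
  · intro h
    exact absurd (ht.mem i j hij) h

/-- At the indices `b c d a` the four inequalities kill every metric term. What remains is the
indicator of `t a b = t c d` minus that of `t a c = t b d`. -/
theorem fano_of_conformallyAssociative (hB : IsSteinerTripleSystem B) (ht : IsThirdPoint B t)
    (hca : ConformallyAssociative (steinerCubic B)) (a b c d : Fin n) (hab : a ≠ b)
    (hac : a ≠ c) (hbd : b ≠ d) (hcd : c ≠ d)
    (h : t a b = t c d) : t a c = t b d := by
  have key := hca b c d a
  have e : ∀ i j : Fin n, i ≠ j → euclideanMetric i j = 0 := fun i j hij => by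
    simp [euclideanMetric, hij]
  rw [conformalNonassociativity, e d b hbd.symm, e d c hcd.symm, e a b hab, e a c hac] at key
  simp only [zero_mul, sub_zero, mul_zero, add_zero, nonassociativity,
    ht.thirdDeriv_steinerCubic hB hab, ht.thirdDeriv_steinerCubic hB hcd,
    ht.thirdDeriv_steinerCubic hB hac, ht.thirdDeriv_steinerCubic hB hbd,
    Finset.sum_sub_distrib] at key
  by_contra hne
  have h1 : ∑ x, (if x = t a b then (1 : MvPolynomial (Fin n) ℝ) else 0) *
      (if x = t c d then 1 else 0) = 1 := by
    simp [h]
  have h2 : ∑ x, (if x = t a c then (1 : MvPolynomial (Fin n) ℝ) else 0) *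
      (if x = t b d then 1 else 0) = 0 := by
    simp [Ne.symm hne]
  rw [h1, h2, sub_zero] at key
  exact one_ne_zero key

end IsThirdPoint

/-! ### Axial vectors -/

/-- `v` is an axial vector of `P` if the central difference of `P` in the direction `v` is, up to
a constant, a combination of the squared norm and the square of a linear form. -/
def IsAxial {n : ℕ} (P : MvPolynomial (Fin n) ℝ) (v : Fin n → ℝ) : Prop :=
  ∃ (a b c : ℝ) (u : Fin n → ℝ), ∀ x,
    eval (x + v) P - eval (x - v) P = a * (x ⬝ᵥ x) + b * (u ⬝ᵥ x) ^ 2 + c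

/-- A conformal map scales the squared norm by `r ^ 2` and pulls linear forms back to linear forms.
-/
theorem IsAxial.of_glAct {n : ℕ} {P : MvPolynomial (Fin n) ℝ} {g : GL (Fin n) ℝ}
    (hg : g ∈ conformalLinearGroup n) {v : Fin n → ℝ} (h : IsAxial (glAct g P) v) :
    IsAxial P ((g⁻¹ : GL (Fin n) ℝ).val.mulVec v) := by
  obtain ⟨a, b, c, u, h⟩ := h
  obtain ⟨r, -, A, hA, hgA⟩ := hg
  refine ⟨a * r ^ 2, b, c, Matrix.vecMul u g.val, fun x => ?_⟩
  have hinv : (g⁻¹ : GL (Fin n) ℝ).val.mulVec (g.val.mulVec x) = x := by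
    rw [Matrix.mulVec_mulVec, ← Units.val_mul, inv_mul_cancel, Units.val_one, Matrix.one_mulVec]
  have hnorm : g.val.mulVec x ⬝ᵥ g.val.mulVec x = r ^ 2 * (x ⬝ᵥ x) := by
    have hAA : A.transpose * A = 1 := (Matrix.mem_orthogonalGroup_iff' _ _).1 hA
    rw [hgA, Matrix.smul_mulVec, smul_dotProduct, dotProduct_smul, Matrix.dotProduct_mulVec,
      Matrix.vecMul_mulVec, hAA, Matrix.vecMul_one, smul_eq_mul, smul_eq_mul]
    ring
  have := h (g.val.mulVec x)
  rw [eval_glAct, eval_glAct, Matrix.mulVec_add, Matrix.mulVec_sub, hinv, hnorm,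
    Matrix.dotProduct_mulVec] at this
  rw [this]; ring

section BlockDifference

variable {α : Type*} [DecidableEq α]

/-- Only terms of odd degree in `w` survive. Those of degree 1 would take two factors from the basis
vector, impossible in a squarefree monomial, so only the cubic terms remain. -/
theorem prod_single_add_sub (b : Finset α) (hb : b.card = 3) (w : α → ℝ) (i : α) :
    (∏ a ∈ b, ((Pi.single i 1 : α → ℝ) a + w a)) - ∏ a ∈ b, ((Pi.single i 1 : α → ℝ) a - w a) =
      (∏ a ∈ b, w a) - ∏ a ∈ b, (- w a) := by
  obtain ⟨x, y, z, hxy, hxz, hyz, rfl⟩ := Finset.card_eq_three.1 hb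
  simp only [Finset.prod_insert, Finset.mem_insert, Finset.mem_singleton, hxy, hxz, hyz, or_self,
    not_false_eq_true, Finset.prod_singleton, Pi.single_apply]
  by_cases h1 : x = i
  · subst h1
    simp only [hxy.symm, hxz.symm, if_true, if_false]; ring
  by_cases h2 : y = i
  · subst h2
    simp only [hxy, hyz.symm, if_true, if_false]; ring
  by_cases h3 : z = i
  · subst h3
    simp only [hxz, hyz, if_true, if_false]; ring
  · simp only [h1, h2, h3, if_false]; ring

theorem prod_pair_add_sub_of_eq {i j k : α} (hij : i ≠ j) (hki : k ≠ i) (hkj : k ≠ j)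
    (w : α → ℝ) :
    (∏ a ∈ {i, j, k}, ((Pi.single i 1 + Pi.single j 1 : α → ℝ) a + w a)) -
        ∏ a ∈ {i, j, k}, ((Pi.single i 1 + Pi.single j 1 : α → ℝ) a - w a) =
      (∏ a ∈ {i, j, k}, w a) - (∏ a ∈ {i, j, k}, (- w a)) + 2 * w k := by
  simp only [Finset.prod_insert, Finset.mem_insert, Finset.mem_singleton, hij, hki.symm, hkj.symm,
    or_self, not_false_eq_true, Finset.prod_singleton, Pi.single_apply, Pi.add_apply, if_true,
    hij.symm, hki, hkj, if_false]
  ring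

theorem prod_pair_add_sub_of_notMem {b : Finset α} (hb : b.card = 3) {i j : α}
    (h : ¬ (i ∈ b ∧ j ∈ b)) (w : α → ℝ) :
    (∏ a ∈ b, ((Pi.single i 1 + Pi.single j 1 : α → ℝ) a + w a)) -
        ∏ a ∈ b, ((Pi.single i 1 + Pi.single j 1 : α → ℝ) a - w a) =
      (∏ a ∈ b, w a) - ∏ a ∈ b, (- w a) := by
  have hz : ∀ i, i ∉ b → ∀ a ∈ b, (Pi.single i 1 : α → ℝ) a = 0 := by
    intro i hi a ha
    rw [Pi.single_apply, if_neg]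
    rintro rfl
    exact hi ha
  by_cases hi : i ∈ b
  · have hj : j ∉ b := fun hj => h ⟨hi, hj⟩
    rw [← prod_single_add_sub b hb w i]
    congr 1 <;> refine Finset.prod_congr rfl fun a ha => ?_ <;>
      rw [Pi.add_apply, hz j hj a ha, add_zero]
  · rw [← prod_single_add_sub b hb w j]
    congr 1 <;> refine Finset.prod_congr rfl fun a ha => ?_ <;>
      rw [Pi.add_apply, hz i hi a ha, zero_add]

end BlockDifference

theorem eval_steinerCubic {n : ℕ} (B : Finset (Finset (Fin n))) (x : Fin n → ℝ) :
    eval x (steinerCubic B) = ∑ b ∈ B, ∏ a ∈ b, x a := by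
  simp [steinerCubic]

/-- Testing the axial identity at `0`, `e_i` and `e_i + e_j` gives `c`, then `a + b * u i ^ 2 = 0`,
then `w (t i j) = b * (u i * u j)`. If `a = 0`, each `b * u i` vanishes and `w = 0`. -/
theorem IsThirdPoint.eq_of_isAxial {n : ℕ} {B : Finset (Finset (Fin n))}
    {t : Fin n → Fin n → Fin n} (hB : IsSteinerTripleSystem B) (ht : IsThirdPoint B t)
    (hmod : n % 4 = 1) (hn : 1 < n) {w : Fin n → ℝ} (hw : IsAxial (steinerCubic B) w)
    (i j : Fin n) : w i = w j := by
  obtain ⟨a, b, c, u, h⟩ := hw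
  have h0 : (∑ s ∈ B, ((∏ p ∈ s, w p) - ∏ p ∈ s, (- w p))) = c := by
    have := h 0
    rw [eval_steinerCubic, eval_steinerCubic, ← Finset.sum_sub_distrib] at this
    simpa using this
  have h1 : ∀ i, a + b * u i ^ 2 = 0 := by
    intro i
    have := h (Pi.single i 1)
    rw [eval_steinerCubic, eval_steinerCubic, ← Finset.sum_sub_distrib,
      show ∑ s ∈ B, ((∏ p ∈ s, (Pi.single i 1 + w : Fin n → ℝ) p) -
        ∏ p ∈ s, (Pi.single i 1 - w : Fin n → ℝ) p) = c from (Finset.sum_congr rfl (fun s hs =>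
          prod_single_add_sub s (hB.card_block s hs) w i)).trans h0] at this
    simp at this
    linarith
  have h2 : ∀ i j, i ≠ j → w (t i j) = b * (u i * u j) := by
    intro i j hij
    have := h (Pi.single i 1 + Pi.single j 1)
    have hs : ∑ s ∈ B, ((∏ p ∈ s, (Pi.single i 1 + Pi.single j 1 + w : Fin n → ℝ) p) -
        ∏ p ∈ s, (Pi.single i 1 + Pi.single j 1 - w : Fin n → ℝ) p) = c + 2 * w (t i j) := by
      rw [← h0, ← sub_eq_iff_eq_add', ← Finset.sum_sub_distrib, Finset.sum_eq_single {i, j, t i j}]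
      · have := prod_pair_add_sub_of_eq hij (ht.ne_left i j hij) (ht.ne_right i j hij) w
        simp only [Pi.add_apply, Pi.sub_apply] at this ⊢
        linarith
      · intro s hs hne
        have := prod_pair_add_sub_of_notMem (hB.card_block s hs) (i := i) (j := j)
          (fun hm => hne (ht.block_eq i j hij s hs hm.1 hm.2)) w
        simp only [Pi.add_apply, Pi.sub_apply] at this ⊢
        linarith
      · intro hm
        exact absurd (ht.mem i j hij) hm
    rw [eval_steinerCubic, eval_steinerCubic, ← Finset.sum_sub_distrib, hs] at this
    simp [dotProduct_add, hij, hij.symm] at this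
    have hi := h1 i
    have hj := h1 j
    linarith
  have : Nontrivial (Fin n) := Fin.nontrivial_iff_two_le.2 hn
  have h3 : ∀ i j, i ≠ j → w i = b * (u j * u (t i j)) := by
    intro i j hij
    have e : t j (t i j) = i := by rw [ht.comm hij, ht.left_inv hij.symm]
    rw [← h2 j (t i j) (ht.ne_right i j hij).symm, e]
  by_cases ha : a = 0
  · have hbu : ∀ i, b * u i = 0 := by
      intro i
      have := h1 i
      rw [ha, zero_add] at this
      rcases mul_eq_zero.1 this with h | h
      · rw [h, zero_mul]
      · rw [pow_eq_zero_iff two_ne_zero] at h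
        rw [h, mul_zero]
    have hw0 : ∀ i, w i = 0 := by
      intro i
      obtain ⟨j, hj⟩ := exists_ne i
      rw [h3 i j hj.symm, ← mul_assoc, hbu, zero_mul]
    rw [hw0, hw0]
  · have hbu : ∀ i, b * u i ^ 2 = - a := fun i => by linarith [h1 i]
    -- The scale is `-a` because the product of `w` over a block is `b ^ 3` times the squares of the
    -- three `u`'s, that is `(-a) ^ 3`.
    have hone := ht.eq_one_of_mul_eq_one hmod hn (fun i => w i / (- a)) ?_ ?_
    · have hi := hone i
      have hj := hone j
      rw [div_eq_one_iff_eq (neg_ne_zero.2 ha)] at hi hj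
      rw [hi, hj]
    · intro i
      obtain ⟨j, hj⟩ := exists_ne i
      have hsq : w i ^ 2 = a ^ 2 := by
        rw [h3 i j hj.symm]
        linear_combination b * u (t i j) ^ 2 * hbu j + (-a) * hbu (t i j)
      rw [← sq_eq_one_iff, div_pow, hsq, neg_sq, div_self (pow_ne_zero 2 ha)]
    · intro i j hij
      have e1 := h3 i j hij
      have e2 := h3 j i hij.symm
      rw [ht.comm hij.symm] at e2
      have e3 := h2 i j hij
      have : w i * w j * w (t i j) = (- a) ^ 3 := by
        rw [e1, e2, e3, ← mul_one ((-a) ^ 3)]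
        calc _ = (b * u i ^ 2) * (b * u j ^ 2) * (b * u (t i j) ^ 2) := by ring
          _ = _ := by rw [hbu, hbu, hbu]; ring
      field_simp
      linarith

/-- For `v` supported on the last two coordinates, `R` cancels in the central difference, and the
other coordinates enter only through their sum of squares. -/
theorem exists_eval_simplicialPoly (k : ℕ) : ∃ (c : ℝ) (R : (Fin k → ℝ) → ℝ), ∀ x : Fin (k + 2) → ℝ,
    eval x (simplicialPoly (k + 2)) = c * (R (fun i => x i.castSucc.castSucc) +
      1 / √(((k : ℝ) + 1) * (k + 2)) * (k * x (Fin.last k).castSucc ^ 3 -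
        3 * x (Fin.last k).castSucc * ∑ i : Fin k, x i.castSucc.castSucc ^ 2) +
      1 / √(((k : ℝ) + 2) * (k + 3)) * ((k + 1) * x (Fin.last (k + 1)) ^ 3 -
        3 * x (Fin.last (k + 1)) * (∑ i : Fin k, x i.castSucc.castSucc ^ 2 +
          x (Fin.last k).castSucc ^ 2))) := by
  refine ⟨√(((k + 2 : ℕ) : ℝ) * (((k + 2 : ℕ) : ℝ) + 1)) / 6,
    fun y => ∑ j : Fin k, 1 / √(((j : ℕ) + 1 : ℝ) * ((j : ℕ) + 2 : ℝ)) *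
      ∑ i, if i < j then (y j ^ 3 - 3 * y j * y i ^ 2) else 0, fun x => ?_⟩
  have hIio : ∀ j : Fin (k + 2), Finset.Iio j = Finset.univ.filter (· < j) := by
    intro j; ext; simp
  simp only [simplicialPoly, hIio, Finset.sum_filter, map_mul, eval_C, map_sum, apply_ite (eval x),
    map_sub, map_pow, eval_X, map_zero, map_ofNat]
  congr 1
  rw [Fin.sum_univ_castSucc, Fin.sum_univ_castSucc]
  simp only [Fin.sum_univ_castSucc (n := k + 1), Fin.sum_univ_castSucc (n := k)]
  have hlast : ∀ {m : ℕ} (a : Fin (m + 1)), ¬ Fin.last m < a := fun a => (Fin.le_last a).not_gt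
  have e₂ : (k : ℝ) + 1 + 1 = k + 2 := by ring
  have e₃ : (k : ℝ) + 1 + 2 = k + 3 := by ring
  simp [Fin.castSucc_lt_last, Finset.sum_sub_distrib, ← Finset.mul_sum, hlast, e₂, e₃]
  left
  ring

theorem exists_isAxial_simplicialPoly (k : ℕ) : ∃ v₁ v₂ : Fin (k + 2) → ℝ,
    IsAxial (simplicialPoly (k + 2)) v₁ ∧ IsAxial (simplicialPoly (k + 2)) v₂ ∧
      v₁ ≠ 0 ∧ ∀ s : ℝ, v₂ ≠ s • v₁ := by
  obtain ⟨c, R, h⟩ := exists_eval_simplicialPoly k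
  set q := 1 / √(((k : ℝ) + 1) * (k + 2)) with hq
  set p := 1 / √(((k : ℝ) + 2) * (k + 3)) with hp
  have hp2 : p ^ 2 * ((k + 2) * (k + 3)) = 1 := by
    rw [hp, div_pow, Real.sq_sqrt (by positivity)]; field_simp
  have hq2 : q ^ 2 * ((k + 1) * (k + 2)) = 1 := by
    rw [hq, div_pow, Real.sq_sqrt (by positivity)]; field_simp
  let v : ℝ → ℝ → Fin (k + 2) → ℝ := fun β α =>
    Fin.snoc (α := fun _ => ℝ) (Fin.snoc (α := fun _ => ℝ) (0 : Fin k → ℝ) β) α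
  have hv0 : ∀ β α (i : Fin k), v β α i.castSucc.castSucc = 0 := by
    intro β α i; simp [v]
  have hv1 : ∀ β α, v β α (Fin.last k).castSucc = β := by
    intro β α; simp [v]
  have hv2 : ∀ β α, v β α (Fin.last (k + 1)) = α := by
    intro β α; simp [v]
  have hdot : ∀ x : Fin (k + 2) → ℝ, x ⬝ᵥ x = ∑ i : Fin k, x i.castSucc.castSucc ^ 2 +
      x (Fin.last k).castSucc ^ 2 + x (Fin.last (k + 1)) ^ 2 := by
    intro x
    simp only [dotProduct, Fin.sum_univ_castSucc, sq]
  have hvdot : ∀ β α (x : Fin (k + 2) → ℝ), v β α ⬝ᵥ x =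
      β * x (Fin.last k).castSucc + α * x (Fin.last (k + 1)) := by
    intro β α x
    simp only [dotProduct, Fin.sum_univ_castSucc, hv0, hv1, hv2]
    simp
  -- For `v 1 α`, the coefficients of `S` and `y ^ 2` give `b = c * (6 * (k + 1) * q)`. The cross
  -- term `-12 * p * y * z` then forces `α = -p / ((k + 1) * q)`, which is `-(k + 2) * p * q` by
  -- `hq2`.
  refine ⟨v 0 1, v 1 (-(k + 2) * p * q), ?_, ?_, ?_, ?_⟩
  · refine ⟨c * (-6 * p), c * (6 * p * (k + 2)), c * (2 * (k + 1) * p), v 0 1, fun x => ?_⟩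
    rw [h, h, hdot, hvdot]
    simp only [Pi.add_apply, Pi.sub_apply, hv0, hv1, hv2, add_zero, sub_zero]
    ring
  · refine ⟨c * (-6 * (-(k + 2) * p * q * p + q)), c * (6 * (k + 1) * q),
      c * (q * (2 * k) + p * ((k + 1) * 2 * (-(k + 2) * p * q) ^ 3 - 6 * (-(k + 2) * p * q))),
      v 1 (-(k + 2) * p * q), fun x => ?_⟩
    rw [h, h, hdot, hvdot]
    simp only [Pi.add_apply, Pi.sub_apply, hv0, hv1, hv2, add_zero, sub_zero]
    generalize x (Fin.last k).castSucc = y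
    generalize x (Fin.last (k + 1)) = z
    generalize ∑ i : Fin k, x i.castSucc.castSucc ^ 2 = S
    linear_combination c * (-6 * z ^ 2 * q * hp2 - 6 * z ^ 2 * q * (k + 2) * p ^ 2 * hq2
      + 12 * p * z * y * hq2)
  · intro h0
    have := hv2 0 1
    rw [h0] at this
    simp at this
  · intro s hs
    have := hv1 1 (-(k + 2) * p * q)
    rw [hs, Pi.smul_apply, hv1] at this
    simp at this

theorem mainTheorem7 (n : ℕ) (hn : 2 ≤ n) (hmod : n % 12 = 1 ∨ n % 12 = 9)
    (B : Finset (Finset (Fin n))) (hB : IsSteinerTripleSystem B) :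
    ¬ ConformallyEquivalent (steinerCubic B) (simplicialPoly n) ∧
      ¬ ConformallyAssociative (steinerCubic B) := by
  obtain ⟨t, ht⟩ := hB.exists_isThirdPoint
  have hmod4 : n % 4 = 1 := by omega
  refine ⟨?_, fun hca => ?_⟩
  · rintro ⟨g, hg, hgP⟩
    obtain ⟨k, rfl⟩ : ∃ k, n = k + 2 := ⟨n - 2, by omega⟩
    obtain ⟨v₁, v₂, h₁, h₂, hne, hindep⟩ := exists_isAxial_simplicialPoly k
    rw [← hgP] at h₁ h₂
    have e₁ := ht.eq_of_isAxial hB hmod4 hn (h₁.of_glAct hg)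
    have e₂ := ht.eq_of_isAxial hB hmod4 hn (h₂.of_glAct hg)
    have hinv : ∀ v, g.val.mulVec ((g⁻¹ : GL (Fin (k + 2)) ℝ).val.mulVec v) = v := by
      intro v
      rw [Matrix.mulVec_mulVec, ← Units.val_mul, mul_inv_cancel, Units.val_one, Matrix.one_mulVec]
    set w₁ := (g⁻¹ : GL (Fin (k + 2)) ℝ).val.mulVec v₁
    set w₂ := (g⁻¹ : GL (Fin (k + 2)) ℝ).val.mulVec v₂
    have hw₁ : w₁ 0 ≠ 0 := by
      intro h0
      apply hne
      have : w₁ = 0 := by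
        ext i
        rw [e₁ i 0, h0, Pi.zero_apply]
      rw [← hinv v₁]
      change g.val.mulVec w₁ = 0
      rw [this, Matrix.mulVec_zero]
    apply hindep (w₂ 0 / w₁ 0)
    have : w₂ = (w₂ 0 / w₁ 0) • w₁ := by
      ext i
      rw [Pi.smul_apply, e₁ i 0, e₂ i 0, smul_eq_mul, div_mul_cancel₀ _ hw₁]
    rw [← hinv v₂, ← hinv v₁, ← Matrix.mulVec_smul]
    exact congrArg _ this
  · have := ht.mod_four_of_fano hn (ht.fano_of_conformallyAssociative hB hca)
    omega
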